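/- Let $d\in\mathbb N_0$, let $X\subseteq\mathbb R^d$ be open, let $\psi:X\to X$ be smooth and injective with $\det J\psi(x)\neq 0$ for all $x\in X$, where $J\psi$ denotes the Jacobian matrix, and let $w\in C^\infty(X)$ be a complex-valued smooth function such that $\{x\in X:\ w(x)\neq 0\}$ is dense in $X$. Let $\mathscr D(X)$ be the space of complex-valued compactly supported smooth functions on $X$ with its standard (LF) locally convex topology, and let $\mathscr D'(X)$ be its dual, equipped with the strong topology of uniform convergence on the bounded subsets of $\mathscr D(X)$. Regard $C(X)$ as a subspace of $\mathscr D'(X)$ through $\langle f,\varphi\rangle=\int_X f\varphi\,dx$. There is exactly one continuous linear operator $C_{w,\psi}$ on $\mathscr D'(X)$ with $C_{w,\psi}(f)=w\cdot(f\circ\psi)$ for all $f\in C(X)$ (the weighted composition operator with weight $w$ and symbol $\psi$), and the following are equivalent. (i) $C_{w,\psi}$ is topologizable on $\mathscr D'(X)$, that is: for every continuous seminorm $p$ on $\mathscr D'(X)$ there is a continuous seminorm $q$ on $\mathscr D'(X)$ such that for every $m\in\mathbb N$ there is $\gamma_m>0$ with $p(C_{w,\psi}^m(u))\le\gamma_m\,q(u)$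 for all $u\in\mathscr D'(X)$. (ii) $\psi$ has stable orbits, that is: for every compact $K\subseteq X$ there is a compact $L\subseteq X$ such that $\psi^m(K)\subseteq L$ for every $m\in\mathbb N$. -/

import Mathlib

open scoped Distributions ContDiff

noncomputable section

/-- `ℝ^d` with its Euclidean norm. -/
abbrev RSpace (d : ℕ) : Type := EuclideanSpace ℝ (Fin d)

/-- The space `𝒟'(X)` of (complex) distributions on the open set `X`: the continuous `ℂ`-linear
forms on the LF-space `𝒟(X)` of complex-valued test functions. It carries the strong dual
topology, i.e. that of uniform convergence on the bounded subsets of `𝒟(X)`. -/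
abbrev DistSpace {d : ℕ} (X : TopologicalSpace.Opens (RSpace d)) : Type :=
  StrongDual ℂ 𝓓(X, ℂ)

/-- The distribution `φ ↦ ∫ φ(x) f(x) dx` on `X` defined by a function `f`
locally integrable on `X` (only the values of `f` on `X` matter). -/
def regularDist {d : ℕ} (X : TopologicalSpace.Opens (RSpace d)) (f : RSpace d → ℂ) :
    DistSpace X :=
  TestFunction.integralAgainstBilinCLM (ContinuousLinearMap.mul ℂ ℂ) MeasureTheory.volume f

/-- `T` is a continuous linear operator on `𝒟'(X)` that extends the weighted composition operator
`f ↦ w · (f ∘ ψ)` on `C(X)`. -/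
def IsWeightedCompositionOperator {d : ℕ} (X : TopologicalSpace.Opens (RSpace d))
    (w : RSpace d → ℂ) (ψ : RSpace d → RSpace d) (T : DistSpace X →L[ℂ] DistSpace X) : Prop :=
  ∀ f : RSpace d → ℂ, ContinuousOn f X →
    T (regularDist X f) = regularDist X (fun x => w x * f (ψ x))

/-- A continuous linear operator `T` on a locally convex space `E` is topologizable if for each
continuous seminorm `p` there is a continuous seminorm `q` such that for all `m` there is
`γ > 0` with `p (T^m x) ≤ γ q x` for all `x`. -/
def IsTopologizable {E : Type*} [AddCommGroup E] [Module ℂ E] [TopologicalSpace E]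
    (T : E →L[ℂ] E) : Prop :=
  ∀ p : Seminorm ℂ E, Continuous p → ∃ q : Seminorm ℂ E, Continuous q ∧
    ∀ m : ℕ, ∃ γ : ℝ, 0 < γ ∧ ∀ x : E, p (T^[m] x) ≤ γ * q x

/-- A self-map `ψ` of a subset `X` of a topological space has stable orbits on `X` if for every
compact `K ⊆ X` there is a compact `L ⊆ X` containing `ψ^m(K)` for all `m`. -/
def HasStableOrbitsOn {E : Type*} [TopologicalSpace E] (X : Set E) (ψ : E → E) : Prop :=
  ∀ K : Set E, IsCompact K → K ⊆ X →
    ∃ L : Set E, IsCompact L ∧ L ⊆ X ∧ ∀ m : ℕ, ψ^[m] '' K ⊆ L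

end

/-!
By change of variables, the weighted composition operator is the transpose of the continuous
operator `S φ = ((w / |det Dψ|) · φ) ∘ ψ⁻¹` on test functions, extended by zero off `ψ(X)`. It is
the only such operator because the continuous functions are dense in `𝓓'(X)`: on a bounded set of
test functions, which has a common compact support and uniform bounds on all derivatives, the
identity is a uniform limit of maps `φ ↦ ∑ₓ (∫ fₓ φ) ρ(· - x)` for a mollifier `ρ` and a fine
partition of unity `(fₓ)`, and composing a distribution with such a map gives a continuous function.

As `w ≠ 0` on a dense set, `supp (Sᵐ φ) = ψᵐ(supp φ)`. Topologizability of the transpose means that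
for every bounded `B` some bounded `B'` controls all the sets `Sᵐ(B)` up to scalars. Testing this
with Dirac distributions at points off the common support of `B'` confines the orbit of `supp φ` to
a compact set. Conversely, if the orbits stay in a compact `L`, then the sets `Sᵐ(B)` lie in the
metrizable space of functions supported in `L`, where countably many bounded sets can be rescaled
to have a bounded union.
-/

open Set Filter TopologicalSpace Topology Bornology MeasureTheory
open scoped Convolution NNReal Pointwise

section StrongDual

variable {𝕜 E F : Type*} [RCLike 𝕜] [AddCommGroup E] [Module 𝕜 E] [TopologicalSpace E]
  [NormedAddCommGroup F] [NormedSpace 𝕜 F] {B : Set E}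

theorem exists_norm_le_of_isVonNBounded (hB : IsVonNBounded 𝕜 B) (u : E →L[𝕜] F) :
    ∃ C : ℝ, 0 ≤ C ∧ ∀ φ ∈ B, ‖u φ‖ ≤ C := by
  obtain ⟨C, hC⟩ := ((NormedSpace.isVonNBounded_iff 𝕜).1 (hB.image u)).exists_norm_le
  exact ⟨max C 0, le_max_right _ _,
    fun φ hφ => (hC _ (mem_image_of_mem _ hφ)).trans (le_max_left _ _)⟩

theorem bddAbove_range_norm_apply (hB : IsVonNBounded 𝕜 B) (u : E →L[𝕜] F) :
    BddAbove (range fun φ : B => ‖u φ‖) := by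
  obtain ⟨C, -, hC⟩ := exists_norm_le_of_isVonNBounded hB u
  exact ⟨C, forall_mem_range.2 fun φ => hC φ φ.2⟩

/-- The seminorm `u ↦ sup_{φ ∈ B} |u(φ)|` on the strong dual, for a bounded set `B`. These
seminorms generate the strong topology. -/
noncomputable def supSeminormOn (hB : IsVonNBounded 𝕜 B) : Seminorm 𝕜 (StrongDual 𝕜 E) :=
  Seminorm.of (fun u => ⨆ φ : B, ‖u φ‖)
    (fun u v => Real.iSup_le
      (fun φ => (norm_add_le _ _).trans
        (add_le_add (le_ciSup (bddAbove_range_norm_apply hB u) φ)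
          (le_ciSup (bddAbove_range_norm_apply hB v) φ)))
      (add_nonneg (Real.iSup_nonneg fun _ => norm_nonneg _)
        (Real.iSup_nonneg fun _ => norm_nonneg _)))
    (fun a u => by
      simp only [smul_apply, norm_smul, Real.mul_iSup_of_nonneg (norm_nonneg a)])

theorem norm_apply_le_supSeminormOn (hB : IsVonNBounded 𝕜 B) (u : StrongDual 𝕜 E) {φ : E}
    (hφ : φ ∈ B) : ‖u φ‖ ≤ supSeminormOn hB u :=
  le_ciSup (bddAbove_range_norm_apply hB u) ⟨φ, hφ⟩

theorem supSeminormOn_le (hB : IsVonNBounded 𝕜 B) {u : StrongDual 𝕜 E} {c : ℝ} (hc : 0 ≤ c)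
    (h : ∀ φ ∈ B, ‖u φ‖ ≤ c) : supSeminormOn hB u ≤ c :=
  Real.iSup_le (fun φ : B => h φ φ.2) hc

theorem continuous_supSeminormOn (hB : IsVonNBounded 𝕜 B) : Continuous (supSeminormOn hB) := by
  refine Seminorm.continuous' (r := 1) ?_
  filter_upwards [ContinuousLinearMap.eventually_nhds_zero_mapsTo hB
    (Metric.closedBall_mem_nhds (0 : 𝕜) one_pos)] with u hu
  rw [Seminorm.mem_closedBall_zero]
  exact supSeminormOn_le hB zero_le_one fun φ hφ => mem_closedBall_zero_iff.1 (hu hφ)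

theorem seminorm_le_inv_mul_of_closedBall_subset {V : Type*} [AddCommGroup V] [Module 𝕜 V]
    {p q : Seminorm 𝕜 V} {r : ℝ} (hr : 0 < r) (h : q.closedBall 0 r ⊆ p.closedBall 0 1) (x : V) :
    p x ≤ r⁻¹ * q x := by
  refine le_of_forall_pos_le_add fun ε hε => ?_
  have hs : 0 < r⁻¹ * q x + ε := by positivity
  have hqx : q ((((r⁻¹ * q x + ε)⁻¹ : ℝ) : 𝕜) • x) ≤ r := by
    rw [map_smul_eq_mul, RCLike.norm_ofReal, abs_of_pos (inv_pos.2 hs), inv_mul_le_iff₀ hs,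
      add_mul, mul_right_comm, inv_mul_cancel₀ hr.ne', one_mul]
    exact le_add_of_nonneg_right (by positivity)
  have hpx := (p.mem_closedBall_zero).1 (h ((q.mem_closedBall_zero).2 hqx))
  rwa [map_smul_eq_mul, RCLike.norm_ofReal, abs_of_pos (inv_pos.2 hs), inv_mul_le_iff₀ hs,
    mul_one] at hpx

theorem exists_le_mul_supSeminormOn {p : Seminorm 𝕜 (StrongDual 𝕜 E)} (hp : Continuous p) :
    ∃ (B : Set E) (hB : IsVonNBounded 𝕜 B) (C : ℝ), 0 < C ∧
      ∀ u, p u ≤ C * supSeminormOn hB u := by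
  have hball : p.closedBall 0 1 ∈ 𝓝 (0 : StrongDual 𝕜 E) :=
    mem_of_superset ((Seminorm.continuous_iff one_pos).1 hp) (p.ball_subset_closedBall 0 1)
  obtain ⟨⟨B, r⟩, ⟨hB, hr⟩, hsub⟩ := (ContinuousLinearMap.hasBasis_nhds_zero_of_basis
    (Metric.nhds_basis_closedBall (x := (0 : 𝕜)))).mem_iff.1 hball
  refine ⟨B, hB, r⁻¹, inv_pos.2 hr,
    seminorm_le_inv_mul_of_closedBall_subset hr fun u hu => hsub fun φ hφ => ?_⟩
  exact mem_closedBall_zero_iff.2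
    ((norm_apply_le_supSeminormOn hB u hφ).trans ((Seminorm.mem_closedBall_zero _).1 hu))

end StrongDual

section Absorption

theorem exists_ne_zero_forall_le_norm_mul_le_one (𝕜 : Type*) [NontriviallyNormedField 𝕜]
    (r : ℕ → ℕ → ℝ) : ∃ c : ℕ → 𝕜, ∀ m, c m ≠ 0 ∧ ∀ i ≤ m, ‖c m‖ * r m i ≤ 1 := by
  have hscale (m : ℕ) : ∃ c : 𝕜, c ≠ 0 ∧ ∀ i ≤ m, ‖c‖ * r m i ≤ 1 := by
    have hs : 0 < ∑ i ∈ Finset.range (m + 1), |r m i| + 1 := by positivity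
    obtain ⟨c, hc0, hc⟩ := NormedField.exists_norm_lt 𝕜 (inv_pos.2 hs)
    refine ⟨c, norm_pos_iff.1 hc0, fun i hi => ?_⟩
    have hi : |r m i| ≤ ∑ i ∈ Finset.range (m + 1), |r m i| :=
      Finset.single_le_sum (fun i _ => abs_nonneg (r m i)) (Finset.mem_range_succ_iff.2 hi)
    calc ‖c‖ * r m i
        ≤ (∑ i ∈ Finset.range (m + 1), |r m i| + 1)⁻¹ *
            (∑ i ∈ Finset.range (m + 1), |r m i| + 1) :=
          mul_le_mul_of_nonneg hc.le (by linarith [le_abs_self (r m i)]) (norm_nonneg c) hs.le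
      _ = 1 := inv_mul_cancel₀ hs.ne'
  choose c hc using hscale
  exact ⟨c, hc⟩

theorem exists_isVonNBounded_iUnion_smul {𝕜 E : Type*} [NontriviallyNormedField 𝕜]
    [AddCommGroup E] [Module 𝕜 E] [TopologicalSpace E] {p : SeminormFamily 𝕜 E ℕ}
    (hp : WithSeminorms p)
    {B : ℕ → Set E} (hB : ∀ m, IsVonNBounded 𝕜 (B m)) :
    ∃ c : ℕ → 𝕜, (∀ m, c m ≠ 0) ∧ IsVonNBounded 𝕜 (⋃ m, c m • B m) := by
  choose r hr0 hr using fun m => hp.isVonNBounded_iff_seminorm_bounded.1 (hB m)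
  -- Diagonal choice: `c m` normalizes the seminorms up to `m` on `B m`, so each seminorm exceeds
  -- `1` on only finitely many of the sets `c m • B m`.
  obtain ⟨c, hc⟩ := exists_ne_zero_forall_le_norm_mul_le_one 𝕜 r
  refine ⟨c, fun m => (hc m).1, hp.isVonNBounded_iff_seminorm_bounded.2 fun i => ?_⟩
  have hpos : ∀ m ∈ Finset.range i, 0 ≤ ‖c m‖ * r m i :=
    fun m _ => mul_nonneg (norm_nonneg _) (hr0 m i).le
  refine ⟨∑ m ∈ Finset.range i, ‖c m‖ * r m i + 2,
    add_pos_of_nonneg_of_pos (Finset.sum_nonneg hpos) two_pos, fun x hx => ?_⟩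
  obtain ⟨m, y, hy, rfl⟩ := mem_iUnion.1 hx
  have hle : p i (c m • y) ≤ ‖c m‖ * r m i := by
    rw [map_smul_eq_mul]
    exact mul_le_mul_of_nonneg_left (hr m i y hy).le (norm_nonneg _)
  rcases lt_or_ge m i with hmi | him
  · linarith [Finset.single_le_sum hpos (Finset.mem_range.2 hmi)]
  · linarith [(hc m).2 i him, Finset.sum_nonneg hpos]

end Absorption

section Transpose

/-- The transpose `u ↦ u ∘ S` of a continuous operator `S`, acting on the strong dual. -/
noncomputable def strongTranspose {𝕜 E : Type*} [RCLike 𝕜] [AddCommGroup E] [Module 𝕜 E]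
    [TopologicalSpace E] (S : E →L[𝕜] E) : StrongDual 𝕜 E →L[𝕜] StrongDual 𝕜 E :=
  ContinuousLinearMap.precomp 𝕜 S

theorem strongTranspose_iterate_apply {𝕜 E : Type*} [RCLike 𝕜] [AddCommGroup E] [Module 𝕜 E]
    [TopologicalSpace E] (S : E →L[𝕜] E) (m : ℕ) (u : StrongDual 𝕜 E) (x : E) :
    (strongTranspose S)^[m] u x = u (S^[m] x) := by
  induction m generalizing x with
  | zero => rfl
  | succ m ih =>
    rw [Function.iterate_succ_apply', Function.iterate_succ_apply]
    exact ih (S x)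

variable {E : Type*} [AddCommGroup E] [Module ℂ E] [TopologicalSpace E] {S : E →L[ℂ] E}

theorem isTopologizable_strongTranspose
    (hS : ∀ B, IsVonNBounded ℂ B → ∃ c : ℕ → ℂ, (∀ m, c m ≠ 0) ∧
      IsVonNBounded ℂ (⋃ m, c m • (S^[m] '' B))) :
    IsTopologizable (strongTranspose S) := by
  intro p hp
  obtain ⟨B, hB, C, hC, hpB⟩ := exists_le_mul_supSeminormOn hp
  obtain ⟨c, hc, hB'⟩ := hS B hB
  refine ⟨supSeminormOn hB', continuous_supSeminormOn hB', fun m =>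
    ⟨C * ‖c m‖⁻¹, mul_pos hC (inv_pos.2 (norm_pos_iff.2 (hc m))), fun u => ?_⟩⟩
  rw [mul_assoc]
  refine (hpB _).trans (mul_le_mul_of_nonneg_left (supSeminormOn_le hB (by positivity)
    fun φ hφ => ?_) hC.le)
  rw [strongTranspose_iterate_apply, le_inv_mul_iff₀ (norm_pos_iff.2 (hc m)), ← norm_smul,
    ← map_smul]
  exact norm_apply_le_supSeminormOn hB' u
    (mem_iUnion.2 ⟨m, smul_mem_smul_set (mem_image_of_mem _ hφ)⟩)

theorem exists_isVonNBounded_forall_apply_iterate_eq_zero [ContinuousSMul ℂ E]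
    (hS : IsTopologizable (strongTranspose S)) (x : E) :
    ∃ B : Set E, IsVonNBounded ℂ B ∧
      ∀ u : StrongDual ℂ E, (∀ y ∈ B, u y = 0) → ∀ m, u (S^[m] x) = 0 := by
  have hx : IsVonNBounded ℂ {x} := isVonNBounded_singleton x
  obtain ⟨q, hq, hpq⟩ := hS (supSeminormOn hx) (continuous_supSeminormOn hx)
  obtain ⟨B, hB, C, hC, hqB⟩ := exists_le_mul_supSeminormOn hq
  refine ⟨B, hB, fun u hu m => ?_⟩
  obtain ⟨γ, hγ, hpm⟩ := hpq m
  have hqu : q u ≤ 0 := by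
    have : supSeminormOn hB u ≤ 0 := supSeminormOn_le hB le_rfl fun y hy => by simp [hu y hy]
    exact (hqB u).trans (mul_nonpos_of_nonneg_of_nonpos hC.le this)
  rw [← norm_le_zero_iff, ← strongTranspose_iterate_apply]
  calc ‖(strongTranspose S)^[m] u x‖
      ≤ supSeminormOn hx ((strongTranspose S)^[m] u) :=
        norm_apply_le_supSeminormOn hx _ (mem_singleton x)
    _ ≤ γ * q u := hpm u
    _ ≤ 0 := mul_nonpos_of_nonneg_of_nonpos hγ.le hqu

end Transpose

theorem exists_compacts_forall_exists_superset {E : Type*} [TopologicalSpace E]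
    [LocallyCompactSpace E] [SecondCountableTopology E] (Ω : Opens E) :
    ∃ K : ℕ → Compacts E, (∀ n, (K n : Set E) ⊆ Ω) ∧
      ∀ L : Set E, IsCompact L → L ⊆ Ω → ∀ᶠ n in atTop, L ⊆ K n := by
  have : LocallyCompactSpace Ω := Ω.isOpen.locallyCompactSpace
  let Ks : CompactExhaustion Ω := default
  refine ⟨fun n => ⟨(↑) '' Ks n, (Ks.isCompact n).image continuous_subtype_val⟩,
    fun n => Subtype.coe_image_subset _ _, fun L hL hLΩ => ?_⟩
  have hL' : IsCompact ((↑) ⁻¹' L : Set Ω) :=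
    Topology.IsInducing.subtypeVal.isCompact_preimage' hL (by simpa using hLΩ)
  obtain ⟨N, hN⟩ := Ks.exists_superset_of_isCompact hL'
  filter_upwards [eventually_ge_atTop N] with n hn y hy
  exact ⟨⟨y, hLΩ hy⟩, Ks.subset hn (hN hy), rfl⟩

section TestFunctions

set_option maxSynthPendingDepth 3

variable {𝕜 E F : Type*} [RCLike 𝕜] [NormedAddCommGroup E] [NormedSpace ℝ E] {Ω : Opens E}
  [NormedAddCommGroup F] [NormedSpace ℝ F] [NormedSpace 𝕜 F] [IsScalarTower ℝ 𝕜 F]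

instance continuousSMul_testFunction : ContinuousSMul 𝕜 𝓓(Ω, F) where
  continuous_smul := by
    let smulI : 𝓓(Ω, F) →L[𝕜] 𝓓(Ω, F) :=
      TestFunction.postcompCLM ((RCLike.I : 𝕜) • ContinuousLinearMap.id 𝕜 F)
    have hsmul (c : 𝕜) (φ : 𝓓(Ω, F)) :
        c • φ = RCLike.re c • φ + RCLike.im c • smulI φ := by
      ext x
      change c • φ x = RCLike.re c • φ x + RCLike.im c • (RCLike.I : 𝕜) • φ x
      rw [← algebraMap_smul 𝕜 (RCLike.re c), ← algebraMap_smul 𝕜 (RCLike.im c), smul_smul,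
        ← add_smul]
      exact congrArg (· • φ x) (RCLike.re_add_im c).symm
    simp only [hsmul]
    fun_prop

variable (𝕜 Ω F) in
/-- The `i`-th derivative, as a continuous operator on test functions with values in the bounded
continuous functions. -/
noncomputable def iteratedFDerivBCF (i : ℕ) :
    𝓓(Ω, F) →L[𝕜] BoundedContinuousFunction E (E [×i]→L[ℝ] F) :=
  TestFunction.limitCLM 𝕜
    (fun φ => ContDiffMapSupportedIn.structureMapCLM 𝕜 ⊤ i
      (.of_support_subset (K := ⟨tsupport φ, φ.hasCompactSupport⟩) φ.contDiff (subset_tsupport φ) :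
        𝓓_{⟨tsupport φ, φ.hasCompactSupport⟩}(E, F)))
    (fun _ _ => ContDiffMapSupportedIn.structureMapCLM 𝕜 ⊤ i)
    (fun _ _ f => DFunLike.coe_injective (by
      rw [ContDiffMapSupportedIn.structureMapCLM_top_apply,
        ContDiffMapSupportedIn.structureMapCLM_top_apply]
      rfl))

theorem iteratedFDerivBCF_apply (i : ℕ) (φ : 𝓓(Ω, F)) (x : E) :
    iteratedFDerivBCF 𝕜 F Ω i φ x = iteratedFDeriv ℝ i φ x :=
  congrFun (ContDiffMapSupportedIn.structureMapCLM_top_apply 𝕜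
    (.of_support_subset (K := ⟨tsupport φ, φ.hasCompactSupport⟩) φ.contDiff (subset_tsupport φ) :
      𝓓_{⟨tsupport φ, φ.hasCompactSupport⟩}(E, F))) x

theorem exists_norm_iteratedFDeriv_le_of_isVonNBounded {B : Set 𝓓(Ω, F)}
    (hB : IsVonNBounded 𝕜 B) (i : ℕ) :
    ∃ C : ℝ, 0 ≤ C ∧ ∀ φ ∈ B, ∀ x, ‖iteratedFDeriv ℝ i φ x‖ ≤ C := by
  obtain ⟨C, hC0, hC⟩ := exists_norm_le_of_isVonNBounded hB (iteratedFDerivBCF 𝕜 F Ω i)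
  refine ⟨C, hC0, fun φ hφ x => ?_⟩
  rw [← iteratedFDerivBCF_apply (𝕜 := 𝕜)]
  exact (BoundedContinuousFunction.norm_coe_le_norm _ x).trans (hC φ hφ)

theorem exists_norm_iteratedFDeriv_le_forall_le_of_isVonNBounded {B : Set 𝓓(Ω, F)}
    (hB : IsVonNBounded 𝕜 B) (k : ℕ) :
    ∃ C : ℝ≥0, ∀ φ ∈ B, ∀ i ≤ k, ∀ x, ‖iteratedFDeriv ℝ i φ x‖ ≤ C := by
  choose C hC0 hC using exists_norm_iteratedFDeriv_le_of_isVonNBounded hB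
  refine ⟨⟨∑ i ∈ Finset.range (k + 1), C i, Finset.sum_nonneg fun i _ => hC0 i⟩,
    fun φ hφ i hi x => (hC i φ hφ x).trans ?_⟩
  exact Finset.single_le_sum (fun i _ => hC0 i) (Finset.mem_range_succ_iff.2 hi)

theorem isVonNBounded_preimage_ofSupportedIn {B : Set 𝓓(Ω, F)} (hB : IsVonNBounded 𝕜 B)
    {K : Compacts E} (hK : (K : Set E) ⊆ Ω) :
    IsVonNBounded 𝕜 (TestFunction.ofSupportedIn hK ⁻¹' B : Set 𝓓_{K}(E, F)) := by
  refine (ContDiffMapSupportedIn.withSeminorms 𝕜 E F ⊤ K).isVonNBounded_iff_seminorm_bounded.2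
    fun i => ?_
  obtain ⟨C, hC0, hC⟩ := exists_norm_iteratedFDeriv_le_of_isVonNBounded hB i
  exact ⟨C + 1, by positivity, fun f hf =>
    ((ContDiffMapSupportedIn.seminorm_top_le_iff 𝕜 hC0 i f).2 fun x _ => hC _ hf x).trans_lt
      (lt_add_one C)⟩

theorem exists_isVonNBounded_iUnion_smul_of_support_subset {B : ℕ → Set 𝓓(Ω, F)}
    (hB : ∀ m, IsVonNBounded 𝕜 (B m)) {L : Compacts E} (hLΩ : (L : Set E) ⊆ Ω)
    (hL : ∀ m, ∀ φ ∈ B m, Function.support φ ⊆ L) :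
    ∃ c : ℕ → 𝕜, (∀ m, c m ≠ 0) ∧ IsVonNBounded 𝕜 (⋃ m, c m • B m) := by
  obtain ⟨c, hc, hbdd⟩ := exists_isVonNBounded_iUnion_smul
    (ContDiffMapSupportedIn.withSeminorms 𝕜 E F ⊤ L)
    (fun m => isVonNBounded_preimage_ofSupportedIn (hB m) hLΩ)
  refine ⟨c, hc, (hbdd.image (TestFunction.ofSupportedInCLM 𝕜 hLΩ)).subset
    (iUnion_subset fun m => ?_)⟩
  rintro _ ⟨φ, hφ, rfl⟩
  let f : 𝓓_{L}(E, F) := .of_support_subset φ.contDiff (hL m φ hφ)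
  exact ⟨c m • f, mem_iUnion.2 ⟨m, smul_mem_smul_set (show f ∈ _ ⁻¹' B m from hφ)⟩, rfl⟩

theorem exists_norm_smul_apply_le_seminorm {x : ℕ → E}
    (hx : ∀ K : Set E, IsCompact K → K ⊆ Ω → ∀ᶠ n in atTop, x n ∉ K) (c : ℕ → 𝕜)
    {K : Compacts E} (hK : (K : Set E) ⊆ Ω) :
    ∃ C : ℝ, 0 ≤ C ∧ ∀ (f : 𝓓_{K}(E, F)) (n : ℕ), ‖c n • f (x n)‖ ≤ C * N[𝕜]_{K, 0} f := by
  obtain ⟨N, hN⟩ := eventually_atTop.1 (hx K K.isCompact hK)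
  have hC : 0 ≤ ∑ n ∈ Finset.range N, ‖c n‖ := Finset.sum_nonneg fun _ _ => norm_nonneg _
  refine ⟨_, hC, fun f n => ?_⟩
  rcases lt_or_ge n N with hn | hn
  · rw [norm_smul]
    exact mul_le_mul (Finset.single_le_sum (f := fun n => ‖c n‖) (fun _ _ => norm_nonneg _)
      (Finset.mem_range.2 hn)) (ContDiffMapSupportedIn.norm_apply_le_seminorm 𝕜) (norm_nonneg _) hC
  · rw [f.zero_on_compl (hN n hn), Pi.zero_apply, smul_zero, norm_zero]
    exact mul_nonneg hC (apply_nonneg _ _)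

theorem exists_clm_apply_eq_smul_apply {x : ℕ → E}
    (hx : ∀ K : Set E, IsCompact K → K ⊆ Ω → ∀ᶠ n in atTop, x n ∉ K) (c : ℕ → 𝕜) :
    ∃ Λ : 𝓓(Ω, F) →L[𝕜] BoundedContinuousFunction ℕ F, ∀ φ n, Λ φ n = c n • φ (x n) := by
  have hbdd (φ : 𝓓(Ω, F)) : ∃ C, ∀ n, ‖c n • φ (x n)‖ ≤ C := by
    obtain ⟨C, -, hC⟩ := exists_norm_smul_apply_le_seminorm (F := F) hx c
      (K := ⟨tsupport φ, φ.hasCompactSupport⟩) φ.tsupport_subset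
    exact ⟨_, hC (.of_support_subset φ.contDiff (subset_tsupport φ))⟩
  choose C₀ hC₀ using hbdd
  let Λ (φ : 𝓓(Ω, F)) : BoundedContinuousFunction ℕ F :=
    .ofNormedAddCommGroup (fun n => c n • φ (x n)) continuous_of_discreteTopology _ (hC₀ φ)
  have hadd (φ χ : 𝓓(Ω, F)) : Λ (φ + χ) = Λ φ + Λ χ :=
    BoundedContinuousFunction.ext fun n => smul_add _ _ _
  have hsmul (a : 𝕜) (φ : 𝓓(Ω, F)) : Λ (a • φ) = a • Λ φ :=
    BoundedContinuousFunction.ext fun n => smul_comm _ _ _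
  refine ⟨TestFunction.mkCLM 𝕜 Λ hadd hsmul fun K hK => ?_, fun φ n => rfl⟩
  obtain ⟨C, hC0, hC⟩ := exists_norm_smul_apply_le_seminorm (F := F) hx c hK
  refine (ContDiffMapSupportedIn.mkCLMtoNormedSpace 𝕜 (Λ ∘ TestFunction.ofSupportedIn hK)
    (fun f g => hadd (.ofSupportedIn hK f) (.ofSupportedIn hK g))
    (fun a f => hsmul a (.ofSupportedIn hK f)) ⟨{0}, C, hC0, fun f => ?_⟩).continuous
  rw [Finset.sup_singleton]
  exact (BoundedContinuousFunction.norm_le (mul_nonneg hC0 (apply_nonneg _ _))).2 (hC f)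

theorem exists_forall_mem_apply_eq_zero_of_isVonNBounded {x : ℕ → E}
    (hx : ∀ K : Set E, IsCompact K → K ⊆ Ω → ∀ᶠ n in atTop, x n ∉ K)
    {B : Set 𝓓(Ω, F)} (hB : IsVonNBounded 𝕜 B) : ∃ n, ∀ φ ∈ B, φ (x n) = 0 := by
  by_contra! hne
  choose φ hφB hφx using hne
  -- Weights so large that the continuous map `φ ↦ (cₙ φ(xₙ))ₙ` is unbounded along `φₙ ∈ B`.
  obtain ⟨Λ, hΛ⟩ := exists_clm_apply_eq_smul_apply (F := F) hx
    (fun n => ((n / ‖φ n (x n)‖ : ℝ) : 𝕜))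
  obtain ⟨C, -, hC⟩ := exists_norm_le_of_isVonNBounded hB Λ
  obtain ⟨n, hn⟩ := exists_nat_gt C
  have hΛn : ‖Λ (φ n) n‖ = n := by
    rw [hΛ, norm_smul, RCLike.norm_ofReal, abs_of_nonneg (by positivity),
      div_mul_cancel₀ _ (norm_ne_zero_iff.2 (hφx n))]
  exact hn.not_ge (hΛn ▸ ((Λ (φ n)).norm_coe_le_norm n).trans (hC _ (hφB n)))

theorem exists_compacts_support_subset_of_isVonNBounded [FiniteDimensional ℝ E]
    {B : Set 𝓓(Ω, F)} (hB : IsVonNBounded 𝕜 B) :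
    ∃ K : Compacts E, (K : Set E) ⊆ Ω ∧ ∀ φ ∈ B, Function.support φ ⊆ K := by
  have : ProperSpace E := FiniteDimensional.proper_real E
  by_contra! hcon
  obtain ⟨K, hKΩ, hK⟩ := exists_compacts_forall_exists_superset Ω
  choose φ hφB hφK using fun n => hcon (K n) (hKΩ n)
  choose x hφx hxK using fun n => not_subset.1 (hφK n)
  obtain ⟨n, hn⟩ := exists_forall_mem_apply_eq_zero_of_isVonNBounded (x := x)
    (fun L hL hLΩ => (hK L hL hLΩ).mono fun n hn hxn => hxK n (hn hxn)) hB
  exact hφx n (hn _ (hφB n))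

theorem exists_testFunction_subset_support [FiniteDimensional ℝ E] {K : Set E} (hK : IsCompact K)
    (hKΩ : K ⊆ Ω) : ∃ φ : 𝓓(Ω, ℂ), K ⊆ Function.support φ := by
  have : ProperSpace E := FiniteDimensional.proper_real E
  obtain ⟨V, hV, hKV, hVΩ, hVc⟩ := exists_open_between_and_isCompact_closure hK Ω.isOpen hKΩ
  obtain ⟨f, hfV, hf, -⟩ := hV.exists_contDiff_support_eq (n := ⊤)
  have hsupp : Function.support (fun x => (f x : ℂ)) = V := by
    rw [← hfV]; ext x; simp
  exact ⟨⟨fun x => (f x : ℂ), Complex.ofRealCLM.contDiff.comp hf,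
    by rwa [HasCompactSupport, tsupport, hsupp], by rwa [tsupport, hsupp]⟩, hKV.trans hsupp.ge⟩

end TestFunctions

section Dynamics

variable {E : Type*} [NormedAddCommGroup E] [NormedSpace ℝ E] {Ω : Opens E}

/-- The Dirac distribution at `y`. It is the zero functional when `y ∉ Ω`. -/
noncomputable def diracDist (Ω : Opens E) (y : E) : StrongDual ℂ 𝓓(Ω, ℂ) where
  toFun φ := φ y
  map_add' _ _ := rfl
  map_smul' _ _ := rfl
  cont := continuous_eval_const y

variable {ψ : E → E} {S : 𝓓(Ω, ℂ) →L[ℂ] 𝓓(Ω, ℂ)}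

theorem tsupport_iterate_eq_image (hS : ∀ φ, tsupport (S φ) = ψ '' tsupport φ) (m : ℕ)
    (φ : 𝓓(Ω, ℂ)) : tsupport (S^[m] φ) = ψ^[m] '' tsupport φ := by
  induction m with
  | zero => simp
  | succ m ih => rw [Function.iterate_succ_apply', hS, ih, Function.iterate_succ', image_comp]

theorem isVonNBounded_image_iterate {𝕜 V : Type*} [NontriviallyNormedField 𝕜] [AddCommGroup V]
    [Module 𝕜 V] [TopologicalSpace V] {B : Set V} (hB : IsVonNBounded 𝕜 B) (S : V →L[𝕜] V)
    (m : ℕ) : IsVonNBounded 𝕜 (S^[m] '' B) := by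
  induction m with
  | zero => simpa using hB
  | succ m ih => rw [Function.iterate_succ', image_comp]; exact ih.image S

variable [FiniteDimensional ℝ E]

theorem isTopologizable_strongTranspose_of_hasStableOrbitsOn
    (hS : ∀ φ, tsupport (S φ) = ψ '' tsupport φ) (hψ : HasStableOrbitsOn (Ω : Set E) ψ) :
    IsTopologizable (strongTranspose S) := by
  refine isTopologizable_strongTranspose fun B hB => ?_
  obtain ⟨K, hKΩ, hK⟩ := exists_compacts_support_subset_of_isVonNBounded hB
  obtain ⟨L, hL, hLΩ, hKL⟩ := hψ K K.isCompact hKΩ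
  refine exists_isVonNBounded_iUnion_smul_of_support_subset (L := ⟨L, hL⟩)
    (fun m => isVonNBounded_image_iterate hB S m) hLΩ ?_
  rintro m _ ⟨φ, hφ, rfl⟩
  calc Function.support (S^[m] φ)
      ⊆ tsupport (S^[m] φ) := subset_tsupport _
    _ = ψ^[m] '' tsupport φ := tsupport_iterate_eq_image hS m φ
    _ ⊆ ψ^[m] '' K := image_mono (closure_minimal (hK φ hφ) K.isCompact.isClosed)
    _ ⊆ L := hKL m

theorem exists_isCompact_tsupport_iterate_subset (hS : IsTopologizable (strongTranspose S))
    (φ : 𝓓(Ω, ℂ)) :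
    ∃ L : Set E, IsCompact L ∧ L ⊆ Ω ∧ ∀ m, tsupport (S^[m] φ) ⊆ L := by
  obtain ⟨B, hB, hker⟩ := exists_isVonNBounded_forall_apply_iterate_eq_zero hS φ
  obtain ⟨L, hLΩ, hL⟩ := exists_compacts_support_subset_of_isVonNBounded hB
  refine ⟨L, L.isCompact, hLΩ, fun m => closure_minimal (fun y hy => ?_) L.isCompact.isClosed⟩
  by_contra hyL
  exact hy (hker (diracDist Ω y)
    (fun χ hχ => Function.notMem_support.1 fun hχy => hyL (hL χ hχ hχy)) m)

theorem isTopologizable_strongTranspose_iff_hasStableOrbitsOn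
    (hS : ∀ φ, tsupport (S φ) = ψ '' tsupport φ) :
    IsTopologizable (strongTranspose S) ↔ HasStableOrbitsOn (Ω : Set E) ψ := by
  refine ⟨fun htop K hK hKΩ => ?_, isTopologizable_strongTranspose_of_hasStableOrbitsOn hS⟩
  obtain ⟨φ, hφ⟩ := exists_testFunction_subset_support hK hKΩ
  obtain ⟨L, hL, hLΩ, hφL⟩ := exists_isCompact_tsupport_iterate_subset htop φ
  refine ⟨L, hL, hLΩ, fun m => (image_mono (hφ.trans (subset_tsupport φ))).trans ?_⟩
  exact tsupport_iterate_eq_image hS m φ ▸ hφL m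

end Dynamics

section Convolution

variable {𝕜 E F : Type*} [RCLike 𝕜] [NormedAddCommGroup E] [NormedSpace ℝ E]
  [FiniteDimensional ℝ E] [MeasurableSpace E] [BorelSpace E] {μ : Measure E}
  [NormedAddCommGroup F] [NormedSpace ℝ F] [NormedSpace 𝕜 F] [IsScalarTower ℝ 𝕜 F]

set_option maxSynthPendingDepth 3

theorem iteratedFDeriv_convolution_lsmul [μ.IsAddHaarMeasure] {a : E → 𝕜}
    (ha : Continuous a) {b : E → F} (hb : ContDiff ℝ ∞ b) (hbc : HasCompactSupport b)
    (i : ℕ) :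
    iteratedFDeriv ℝ i (a ⋆[ContinuousLinearMap.lsmul ℝ 𝕜, μ] b) =
      a ⋆[ContinuousLinearMap.lsmul ℝ 𝕜, μ] iteratedFDeriv ℝ i b := by
  induction i with
  | zero =>
    ext1 y
    rw [iteratedFDeriv_zero_eq_comp, iteratedFDeriv_zero_eq_comp]
    exact (((continuousMultilinearCurryFin0 ℝ E F).symm.toContinuousLinearEquiv).integral_comp_comm
      (μ := μ) fun t => a t • b (y - t)).symm
  | succ i ih =>
    ext1 y
    have hderiv := (hbc.iteratedFDeriv i).hasFDerivAt_convolution_right (μ := μ)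
      (ContinuousLinearMap.lsmul ℝ 𝕜) ha.locallyIntegrable
      (hb.iteratedFDeriv_right (m := 1) (by exact_mod_cast le_top)) y
    rw [iteratedFDeriv_succ_eq_comp_left, iteratedFDeriv_succ_eq_comp_left, Function.comp_apply,
      ih, hderiv.fderiv]
    exact (((continuousMultilinearCurryLeftEquiv ℝ (fun _ : Fin (i + 1) => E) F).symm
      |>.toContinuousLinearEquiv).integral_comp_comm (μ := μ)
      fun t => a t • fderiv ℝ (iteratedFDeriv ℝ i b) (y - t)).symm

theorem norm_convolution_sub_smul_le [CompleteSpace F] [IsFiniteMeasureOnCompacts μ] {a : E → 𝕜}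
    (ha : Continuous a) {x₀ : E} {η : ℝ} (hsupp : Function.support a ⊆ Metric.closedBall x₀ η)
    {b : E → F} {M : ℝ≥0} (hb : LipschitzWith M b) (y : E) :
    ‖(a ⋆[ContinuousLinearMap.lsmul ℝ 𝕜, μ] b) y - (∫ t, a t ∂μ) • b (y - x₀)‖ ≤
      η * (∫ t, ‖a t‖ ∂μ) * M := by
  have hac : HasCompactSupport a :=
    .of_support_subset_isCompact (isCompact_closedBall x₀ η) hsupp
  have hai : Integrable a μ := ha.integrable_of_hasCompactSupport hac
  have hint : Integrable (fun t => a t • b (y - t)) μ :=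
    (ha.smul (hb.continuous.comp (continuous_sub_left y))).integrable_of_hasCompactSupport
      hac.smul_right
  have heq : (a ⋆[ContinuousLinearMap.lsmul ℝ 𝕜, μ] b) y - (∫ t, a t ∂μ) • b (y - x₀) =
      ∫ t, a t • (b (y - t) - b (y - x₀)) ∂μ := by
    simp_rw [smul_sub]
    rw [integral_sub hint (hai.smul_const _), integral_smul_const]
    rfl
  rw [heq]
  calc ‖∫ t, a t • (b (y - t) - b (y - x₀)) ∂μ‖ ≤ ∫ t, ‖a t‖ * (M * η) ∂μ := by
        refine norm_integral_le_of_norm_le (hai.norm.mul_const _) (.of_forall fun t => ?_)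
        rw [norm_smul]
        rcases eq_or_ne (a t) 0 with ht | ht
        · simp [ht]
        refine mul_le_mul_of_nonneg_left ((hb.norm_sub_le _ _).trans ?_) (norm_nonneg _)
        rw [sub_sub_sub_cancel_left, norm_sub_rev, ← dist_eq_norm]
        exact mul_le_mul_of_nonneg_left (hsupp ht) M.2
    _ = η * (∫ t, ‖a t‖ ∂μ) * M := by rw [integral_mul_const]; ring

theorem norm_iteratedFDeriv_convolution_sub_smul_le [CompleteSpace F] [μ.IsAddHaarMeasure]
    {a : E → 𝕜} (ha : Continuous a) {x₀ : E} {η : ℝ}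
    (hsupp : Function.support a ⊆ Metric.closedBall x₀ η)
    {b : E → F} (hb : ContDiff ℝ ∞ b) (hbc : HasCompactSupport b) {i : ℕ} {M : ℝ≥0}
    (hM : ∀ y, ‖iteratedFDeriv ℝ (i + 1) b y‖ ≤ M) (y : E) :
    ‖iteratedFDeriv ℝ i (a ⋆[ContinuousLinearMap.lsmul ℝ 𝕜, μ] b) y -
        (∫ t, a t ∂μ) • iteratedFDeriv ℝ i b (y - x₀)‖ ≤ η * (∫ t, ‖a t‖ ∂μ) * M := by
  have hlip : LipschitzWith M (iteratedFDeriv ℝ i b) :=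
    lipschitzWith_of_nnnorm_fderiv_le
      (hb.differentiable_iteratedFDeriv (by exact_mod_cast ENat.natCast_lt_top i)) fun z => by
        rw [← NNReal.coe_le_coe, coe_nnnorm, norm_fderiv_iteratedFDeriv]
        exact hM z
  rw [iteratedFDeriv_convolution_lsmul ha hb hbc]
  exact norm_convolution_sub_smul_le ha hsupp hlip y

end Convolution

section FiniteRankConvolution

theorem exists_partitionOfUnity_isSubordinate_ball {E : Type*} [MetricSpace E] {K : Set E}
    (hK : IsCompact K) {η : ℝ} (hη : 0 < η) :
    ∃ (t : Finset E) (f : PartitionOfUnity t E K), (t : Set E) ⊆ K ∧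
      f.IsSubordinate fun x => Metric.ball (x : E) η := by
  obtain ⟨t, htK, ht⟩ := hK.elim_nhds_subcover (fun x => Metric.ball x η)
    fun x _ => Metric.ball_mem_nhds x hη
  obtain ⟨f, hf⟩ := PartitionOfUnity.exists_isSubordinate_of_locallyFinite hK.isClosed
    (fun x : t => Metric.ball (x : E) η) (fun _ => Metric.isOpen_ball)
    (locallyFinite_of_finite _) (by simpa [iUnion_subtype] using ht)
  exact ⟨t, f, htK, hf⟩

theorem sum_partitionOfUnity_eq_one {E ι : Type*} [TopologicalSpace E] [Fintype ι] {K : Set E}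
    (f : PartitionOfUnity ι E K) {y : E} (hy : y ∈ K) : ∑ j, f j y = 1 :=
  (finsum_eq_sum_of_fintype _).symm.trans (f.sum_eq_one hy)

theorem sum_integral_norm_partitionOfUnity_smul {ι E F : Type*} [Fintype ι] [TopologicalSpace E]
    [MeasurableSpace E] [OpensMeasurableSpace E] {μ : Measure E} [IsFiniteMeasureOnCompacts μ]
    [NormedAddCommGroup F] [NormedSpace ℝ F] {K : Set E} (f : PartitionOfUnity ι E K) {φ : E → F}
    (hφ : Continuous φ) (hφc : HasCompactSupport φ) (hφK : Function.support φ ⊆ K) :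
    ∑ j, ∫ s, ‖f j s • φ s‖ ∂μ = ∫ s, ‖φ s‖ ∂μ := by
  rw [← integral_finsetSum]
  · refine integral_congr_ae (.of_forall fun s => ?_)
    simp only [norm_smul, Real.norm_of_nonneg (f.nonneg _ _)]
    rw [← Finset.sum_mul]
    by_cases hs : φ s = 0
    · simp [hs]
    · rw [sum_partitionOfUnity_eq_one f (hφK hs), one_mul]
  · exact fun j _ => (((f j).continuous.smul hφ).integrable_of_hasCompactSupport
      hφc.smul_left).norm

theorem integral_norm_le_mul_measureReal_of_support_subset {E F : Type*} [MeasurableSpace E]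
    {μ : Measure E} [NormedAddCommGroup F] {K : Set E} (hK : μ K < ⊤) {φ : E → F}
    (hφK : Function.support φ ⊆ K) {M : ℝ} (hM : ∀ y, ‖φ y‖ ≤ M) :
    ∫ s, ‖φ s‖ ∂μ ≤ M * μ.real K := by
  rw [← setIntegral_eq_integral_of_forall_compl_eq_zero (s := K)
    fun x hx => by rw [Function.notMem_support.1 fun h => hx (hφK h), norm_zero]]
  refine (Real.le_norm_self _).trans (norm_setIntegral_le_of_norm_le_const hK fun x _ => ?_)
  rw [norm_norm]
  exact hM x

variable {𝕜 E : Type*} [RCLike 𝕜] [NormedAddCommGroup E] [MeasurableSpace E] {μ : Measure E}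
  {K : Set E} {t : Finset E} (f : PartitionOfUnity t E K) {ρ φ : E → 𝕜}

variable (μ) in
/-- The finite-rank approximation `∑ₓ (∫ fₓ φ) ρ(· - x)` of the convolution `ρ ⋆ φ`, for a partition
of unity `(fₓ)` indexed by finitely many points `x`. It is meant for partitions in which `fₓ` is
supported near `x`. -/
noncomputable def finiteRankConvolution (ρ φ : E → 𝕜) (y : E) : 𝕜 :=
  ∑ x, (∫ s, f x s • φ s ∂μ) • ρ (y - x)

variable [NormedSpace ℝ E]

theorem iteratedFDeriv_finiteRankConvolution (hρ : ContDiff ℝ ∞ ρ) (i : ℕ) (y : E) :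
    iteratedFDeriv ℝ i (finiteRankConvolution μ f ρ φ) y =
      ∑ x, (∫ s, f x s • φ s ∂μ) • iteratedFDeriv ℝ i ρ (y - x) := by
  have hρi : ContDiff ℝ i ρ := hρ.of_le (by exact_mod_cast le_top)
  have htrans (x : t) : ContDiff ℝ i fun y => ρ (y - x) :=
    hρi.comp (contDiff_id.sub contDiff_const)
  unfold finiteRankConvolution
  rw [iteratedFDeriv_fun_sum_apply fun x _ => ((htrans x).const_smul _).contDiffAt]
  refine Finset.sum_congr rfl fun x _ => ?_
  rw [iteratedFDeriv_const_smul_apply' (htrans x).contDiffAt, iteratedFDeriv_comp_sub]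

variable [FiniteDimensional ℝ E] [BorelSpace E] [μ.IsAddHaarMeasure]

theorem convolution_eq_sum_convolution_partitionOfUnity (hφ : Continuous φ)
    (hφc : HasCompactSupport φ) (hφK : Function.support φ ⊆ K) (hρ : Continuous ρ) :
    ρ ⋆[ContinuousLinearMap.lsmul ℝ 𝕜, μ] φ =
      fun y => ∑ x, ((fun s => f x s • φ s) ⋆[ContinuousLinearMap.lsmul ℝ 𝕜, μ] ρ) y := by
  ext y
  rw [← convolution_flip]
  simp only [convolution_def, ContinuousLinearMap.flip_apply, ContinuousLinearMap.lsmul_apply]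
  rw [← integral_finsetSum]
  · refine integral_congr_ae (.of_forall fun s => ?_)
    simp only
    rw [← Finset.sum_smul, ← Finset.sum_smul]
    by_cases hs : φ s = 0
    · simp [hs]
    · rw [sum_partitionOfUnity_eq_one f (hφK hs), one_smul, smul_eq_mul, smul_eq_mul, mul_comm]
  · exact fun x _ => (((f x).continuous.smul hφ).smul (hρ.comp (continuous_sub_left y)))
      |>.integrable_of_hasCompactSupport hφc.smul_left.smul_right

theorem norm_iteratedFDeriv_convolution_sub_finiteRankConvolution_le {η : ℝ}
    (hf : f.IsSubordinate fun x => Metric.ball (x : E) η) (hφ : Continuous φ)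
    (hφc : HasCompactSupport φ) (hφK : Function.support φ ⊆ K)
    (hρ : ContDiff ℝ ∞ ρ) (hρc : HasCompactSupport ρ) {i : ℕ} {R : ℝ≥0}
    (hR : ∀ y, ‖iteratedFDeriv ℝ (i + 1) ρ y‖ ≤ R) (y : E) :
    ‖iteratedFDeriv ℝ i (ρ ⋆[ContinuousLinearMap.lsmul ℝ 𝕜, μ] φ) y -
      iteratedFDeriv ℝ i (finiteRankConvolution μ f ρ φ) y‖ ≤ η * (∫ s, ‖φ s‖ ∂μ) * R := by
  have hcont (x : t) : Continuous fun s => f x s • φ s := (f x).continuous.smul hφ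
  have hsupp (x : t) : Function.support (fun s => f x s • φ s) ⊆ Metric.closedBall x η :=
    fun s hs => Metric.ball_subset_closedBall
      (hf x (subset_tsupport _ fun h => hs (by simp [h])))
  have hconv (x : t) : ContDiff ℝ i
      ((fun s => f x s • φ s) ⋆[ContinuousLinearMap.lsmul ℝ 𝕜, μ] ρ) :=
    (hρc.contDiff_convolution_right _ (hcont x).locallyIntegrable hρ).of_le
      (by exact_mod_cast le_top)
  rw [convolution_eq_sum_convolution_partitionOfUnity f hφ hφc hφK hρ.continuous,
    iteratedFDeriv_fun_sum_apply fun x _ => (hconv x).contDiffAt,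
    iteratedFDeriv_finiteRankConvolution f hρ, ← Finset.sum_sub_distrib,
    ← sum_integral_norm_partitionOfUnity_smul f hφ hφc hφK, Finset.mul_sum, Finset.sum_mul]
  exact (norm_sum_le _ _).trans (Finset.sum_le_sum fun x _ =>
    norm_iteratedFDeriv_convolution_sub_smul_le (hcont x) (hsupp x) hρ hρc hR y)

theorem norm_iteratedFDeriv_sub_finiteRankConvolution_le {η δ : ℝ}
    (hf : f.IsSubordinate fun x => Metric.ball (x : E) η) (hφ : ContDiff ℝ ∞ φ)
    (hφc : HasCompactSupport φ) (hφK : Function.support φ ⊆ K)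
    (hρ : ContDiff ℝ ∞ ρ) (hρs : Function.support ρ ⊆ Metric.closedBall 0 δ)
    (hρ1 : ∫ s, ρ s ∂μ = 1) (hρn : ∫ s, ‖ρ s‖ ∂μ = 1) {i : ℕ} {M R : ℝ≥0}
    (hM : ∀ y, ‖iteratedFDeriv ℝ (i + 1) φ y‖ ≤ M)
    (hR : ∀ y, ‖iteratedFDeriv ℝ (i + 1) ρ y‖ ≤ R) (y : E) :
    ‖iteratedFDeriv ℝ i φ y - iteratedFDeriv ℝ i (finiteRankConvolution μ f ρ φ) y‖ ≤
      δ * M + η * (∫ s, ‖φ s‖ ∂μ) * R := by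
  have hφρ := norm_iteratedFDeriv_convolution_sub_smul_le (μ := μ) hρ.continuous hρs hφ hφc hM y
  rw [hρ1, hρn, one_smul, sub_zero, mul_one, norm_sub_rev] at hφρ
  have hρc : HasCompactSupport ρ := .of_support_subset_isCompact (isCompact_closedBall 0 δ) hρs
  exact (norm_sub_le_norm_sub_add_norm_sub _ _ _).trans (add_le_add hφρ
    (norm_iteratedFDeriv_convolution_sub_finiteRankConvolution_le f hf hφ.continuous hφc hφK
      hρ hρc hR y))

variable (𝕜 μ) in
theorem exists_mollifier {δ : ℝ} (hδ : 0 < δ) :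
    ∃ ρ : E → 𝕜, ContDiff ℝ ∞ ρ ∧ Function.support ρ ⊆ Metric.closedBall 0 δ ∧
      ∫ t, ρ t ∂μ = 1 ∧ ∫ t, ‖ρ t‖ ∂μ = 1 := by
  let f : ContDiffBump (0 : E) := ⟨δ / 2, δ, half_pos hδ, half_lt_self hδ⟩
  refine ⟨fun t => (f.normed μ t : 𝕜), (RCLike.ofRealCLM (K := 𝕜)).contDiff.comp f.contDiff_normed,
    fun t ht => ?_, ?_, ?_⟩
  · have ht : t ∈ Function.support (f.normed μ) := fun h => ht (by simp [h])
    rw [f.support_normed_eq] at ht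
    exact Metric.ball_subset_closedBall ht
  · rw [integral_ofReal, f.integral_normed, RCLike.ofReal_one]
  · simp only [RCLike.norm_ofReal, abs_of_nonneg (f.nonneg_normed _), f.integral_normed]

variable (𝕜 μ) in
theorem exists_norm_iteratedFDeriv_sub_finiteRankConvolution_le (hK : IsCompact K) (k : ℕ)
    (M : ℝ≥0) {δ₀ ε : ℝ} (hδ₀ : 0 < δ₀) (hε : 0 < ε) :
    ∃ ρ : E → 𝕜, ContDiff ℝ ∞ ρ ∧ Function.support ρ ⊆ Metric.closedBall 0 δ₀ ∧
      ∃ (t : Finset E) (f : PartitionOfUnity t E K), (t : Set E) ⊆ K ∧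
        ∀ φ : E → 𝕜, ContDiff ℝ ∞ φ → Function.support φ ⊆ K →
          (∀ i ≤ k + 1, ∀ y, ‖iteratedFDeriv ℝ i φ y‖ ≤ M) → ∀ i ≤ k, ∀ y,
            ‖iteratedFDeriv ℝ i φ y - iteratedFDeriv ℝ i (finiteRankConvolution μ f ρ φ) y‖ ≤
              ε := by
  obtain ⟨δ₁, hδ₁, hδ₁M⟩ := exists_pos_mul_lt (half_pos hε) M
  obtain ⟨ρ, hρ, hρs, hρ1, hρn⟩ := exists_mollifier 𝕜 μ (lt_min hδ₁ hδ₀)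
  let ρ' : 𝓓(⊤, 𝕜) := ⟨ρ, hρ, .of_support_subset_isCompact (isCompact_closedBall _ _) hρs,
    subset_univ _⟩
  obtain ⟨R, hR⟩ := exists_norm_iteratedFDeriv_le_forall_le_of_isVonNBounded (𝕜 := 𝕜)
    (isVonNBounded_singleton ρ') (k + 1)
  obtain ⟨η, hη, hηR⟩ := exists_pos_mul_lt (half_pos hε) (M * μ.real K * R)
  obtain ⟨t, f, htK, hf⟩ := exists_partitionOfUnity_isSubordinate_ball hK hη
  refine ⟨ρ, hρ, hρs.trans (Metric.closedBall_subset_closedBall (min_le_right _ _)), t, f, htK,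
    fun φ hφ hφK hM i hi y => ?_⟩
  have hφc : HasCompactSupport φ := .of_support_subset_isCompact hK hφK
  have hφ1 : ∫ s, ‖φ s‖ ∂μ ≤ M * μ.real K :=
    integral_norm_le_mul_measureReal_of_support_subset hK.measure_lt_top hφK fun s => by
      simpa using hM 0 (Nat.zero_le _) s
  calc ‖iteratedFDeriv ℝ i φ y - iteratedFDeriv ℝ i (finiteRankConvolution μ f ρ φ) y‖
      ≤ min δ₁ δ₀ * M + η * (∫ s, ‖φ s‖ ∂μ) * R :=
        norm_iteratedFDeriv_sub_finiteRankConvolution_le f hf hφ hφc hφK hρ hρs hρ1 hρn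
          (hM _ (by lia)) (hR ρ' rfl _ (by lia)) y
    _ ≤ δ₁ * M + η * (M * μ.real K) * R := by
        gcongr
        exact min_le_left _ _
    _ ≤ ε := by linarith

end FiniteRankConvolution

section Density

theorem exists_forall_norm_iteratedFDeriv_le_imp_norm_apply_le {𝕜 E F : Type*} [RCLike 𝕜]
    [NormedAddCommGroup E] [NormedSpace ℝ E] [NormedAddCommGroup F] [NormedSpace ℝ F]
    [NormedSpace 𝕜 F] [IsScalarTower ℝ 𝕜 F] {Ω : Opens E} (u : StrongDual 𝕜 𝓓(Ω, F))
    {K : Compacts E} (hK : (K : Set E) ⊆ Ω) :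
    ∃ (k : ℕ) (C : ℝ≥0), ∀ φ : 𝓓(Ω, F), Function.support φ ⊆ K → ∀ c : ℝ, 0 ≤ c →
      (∀ i ≤ k, ∀ y, ‖iteratedFDeriv ℝ i φ y‖ ≤ c) → ‖u φ‖ ≤ C * c := by
  obtain ⟨s, C, -, hC⟩ := Seminorm.bound_of_continuous
    (ContDiffMapSupportedIn.withSeminorms 𝕜 E F ⊤ K)
    ((normSeminorm 𝕜 𝕜).comp (u.comp (TestFunction.ofSupportedInCLM 𝕜 hK)).toLinearMap)
    (u.comp (TestFunction.ofSupportedInCLM 𝕜 hK)).continuous.norm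
  refine ⟨s.sup id, C, fun φ hφ c hc h =>
    (hC (.of_support_subset φ.contDiff hφ)).trans (mul_le_mul_of_nonneg_left ?_ C.2)⟩
  exact Seminorm.finset_sup_apply_le hc fun i hi =>
    (ContDiffMapSupportedIn.seminorm_top_le_iff 𝕜 hc i _).2 fun y _ =>
      h i (Finset.le_sup (f := id) hi) y

theorem exists_norm_iteratedFDeriv_sub_sum_smul_le {𝕜 E : Type*} [RCLike 𝕜]
    [NormedAddCommGroup E] [NormedSpace ℝ E] [FiniteDimensional ℝ E] [MeasurableSpace E]
    [BorelSpace E] (μ : Measure E) [μ.IsAddHaarMeasure] {Ω : Opens E} {B : Set 𝓓(Ω, 𝕜)}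
    (hB : IsVonNBounded 𝕜 B) :
    ∃ K L : Compacts E, (L : Set E) ⊆ Ω ∧ ∀ (k : ℕ) (ε : ℝ), 0 < ε →
      ∃ (t : Finset E) (f : PartitionOfUnity t E (K : Set E)) (τ : t → 𝓓(Ω, 𝕜)), ∀ φ ∈ B,
        Function.support (φ - ∑ x, (∫ s, f x s • φ s ∂μ) • τ x) ⊆ L ∧ ∀ i ≤ k, ∀ y,
          ‖iteratedFDeriv ℝ i (φ - ∑ x, (∫ s, f x s • φ s ∂μ) • τ x) y‖ ≤ ε := by
  have : ProperSpace E := FiniteDimensional.proper_real E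
  obtain ⟨K, hKΩ, hK⟩ := exists_compacts_support_subset_of_isVonNBounded hB
  obtain ⟨δ, hδ, hδΩ⟩ := K.isCompact.exists_cthickening_subset_open Ω.isOpen hKΩ
  let L : Compacts E := ⟨Metric.cthickening δ K, K.isCompact.cthickening⟩
  refine ⟨K, L, hδΩ, fun k ε hε => ?_⟩
  obtain ⟨M, hM⟩ := exists_norm_iteratedFDeriv_le_forall_le_of_isVonNBounded hB (k + 1)
  obtain ⟨ρ, hρ, hρδ, t, f, htK, hf⟩ :=
    exists_norm_iteratedFDeriv_sub_finiteRankConvolution_le 𝕜 μ K.isCompact k M hδ hε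
  have hρL (x : t) : Function.support (fun y => ρ (y - x)) ⊆ L := fun y hy =>
    Metric.mem_cthickening_of_dist_le y x δ K (htK x.2)
      ((dist_eq_norm y _).trans_le (mem_closedBall_zero_iff.1 (hρδ hy)))
  let τ (x : t) : 𝓓(Ω, 𝕜) := TestFunction.ofSupportedIn (K := L) hδΩ
    (.of_support_subset (hρ.comp (contDiff_id.sub contDiff_const)) (hρL x))
  refine ⟨t, f, τ, fun φ hφ => ?_⟩
  have hcoe : ⇑(∑ x, (∫ s, f x s • φ s ∂μ) • τ x) = finiteRankConvolution μ f ρ φ := by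
    ext y
    rw [FunLike.coe_sum, Finset.sum_apply]
    rfl
  constructor
  · refine (Function.support_sub _ _).trans (union_subset
      ((hK φ hφ).trans (Metric.self_subset_cthickening _)) ?_)
    rw [hcoe]
    exact (Finset.support_sum _ _).trans (iUnion₂_subset fun x _ =>
      fun y hy => hρL x (right_ne_zero_of_smul hy))
  · intro i hi y
    have hsmooth (χ : 𝓓(Ω, 𝕜)) : ContDiffAt ℝ i χ y :=
      (χ.contDiff.of_le (by exact_mod_cast le_top)).contDiffAt
    rw [FunLike.coe_sub, iteratedFDeriv_sub_apply (hsmooth _) (hsmooth _), hcoe]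
    exact hf φ φ.contDiff (hK φ hφ) (hM φ hφ) i hi y

variable {d : ℕ} {X : Opens (RSpace d)}

theorem regularDist_apply {f : RSpace d → ℂ} (hf : ContinuousOn f X) (φ : 𝓓(X, ℂ)) :
    regularDist X f φ = ∫ x, φ x * f x := by
  have h : LocallyIntegrableOn f X volume := hf.locallyIntegrableOn X.isOpen.measurableSet
  simp [regularDist, h]

theorem regularDist_sum_mul_partitionOfUnity {t : Finset (RSpace d)} {K : Set (RSpace d)}
    (f : PartitionOfUnity t (RSpace d) K) (u : DistSpace X) (τ : t → 𝓓(X, ℂ)) (φ : 𝓓(X, ℂ)) :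
    regularDist X (fun y => ∑ x, u (τ x) * f x y) φ =
      u (∑ x, (∫ s, f x s • φ s) • τ x) := by
  have hcont (x : t) : Continuous fun y => u (τ x) * f x y := by fun_prop
  rw [regularDist_apply (continuous_finsetSum _ fun x _ => hcont x).continuousOn, map_sum]
  simp_rw [map_smul, Finset.mul_sum, smul_eq_mul]
  rw [integral_finsetSum]
  rotate_left
  · exact fun x _ => (φ.continuous.mul (hcont x)).integrable_of_hasCompactSupport
      φ.hasCompactSupport.mul_right
  refine Finset.sum_congr rfl fun x _ => ?_
  rw [← integral_mul_const]
  congr with s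
  rw [Complex.real_smul]
  ring

theorem exists_continuous_norm_sub_regularDist_le (u : DistSpace X) {B : Set 𝓓(X, ℂ)}
    (hB : IsVonNBounded ℂ B) {ε : ℝ} (hε : 0 < ε) :
    ∃ f : RSpace d → ℂ, Continuous f ∧ ∀ φ ∈ B, ‖u φ - regularDist X f φ‖ ≤ ε := by
  obtain ⟨K, L, hLX, happrox⟩ := exists_norm_iteratedFDeriv_sub_sum_smul_le volume hB
  obtain ⟨k, C, hC⟩ := exists_forall_norm_iteratedFDeriv_le_imp_norm_apply_le u hLX
  obtain ⟨c, hc, hCc⟩ := exists_pos_mul_lt hε C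
  obtain ⟨t, f, τ, hτ⟩ := happrox k c hc
  refine ⟨fun y => ∑ x, u (τ x) * f x y, by fun_prop, fun φ hφ => ?_⟩
  rw [regularDist_sum_mul_partitionOfUnity, ← map_sub]
  exact (hC _ (hτ φ hφ).1 c hc.le (hτ φ hφ).2).trans hCc.le

theorem dense_regularDist_image_continuous : Dense (regularDist X '' {f | Continuous f}) := by
  refine fun u => mem_closure_iff_nhds_zero.2 fun U hU => ?_
  obtain ⟨⟨B, r⟩, ⟨hB, hr⟩, hBr⟩ := (ContinuousLinearMap.hasBasis_nhds_zero_of_basis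
    (Metric.nhds_basis_closedBall (x := (0 : ℂ)))).mem_iff.1 hU
  obtain ⟨f, hf, hfB⟩ := exists_continuous_norm_sub_regularDist_le u hB hr
  refine ⟨_, mem_image_of_mem _ hf, hBr fun φ hφ => mem_closedBall_zero_iff.2 ?_⟩
  rw [sub_apply, norm_sub_rev]
  exact hfB φ hφ

end Density

section OpenSmoothEmbedding

theorem contDiff_continuousLinearMap_det {E : Type*} [NormedAddCommGroup E] [NormedSpace ℝ E]
    [FiniteDimensional ℝ E] {n : WithTop ℕ∞} : ContDiff ℝ n fun f : E →L[ℝ] E => f.det := by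
  let b := Module.finBasis ℝ E
  have hdet : (fun f : E →L[ℝ] E => f.det) =
      fun f => ∑ σ : Equiv.Perm (Fin (Module.finrank ℝ E)),
        (Equiv.Perm.sign σ : ℤ) • ∏ i, (b.coord (σ i)).toContinuousLinearMap (f (b i)) := by
    ext f
    rw [ContinuousLinearMap.det, ← LinearMap.det_toMatrix b, Matrix.det_apply]
    simp [LinearMap.toMatrix_apply, Units.smul_def]
  rw [hdet]
  refine ContDiff.sum fun σ _ => ContDiff.const_smul _ (contDiff_prod fun i _ => ?_)
  exact (ContinuousLinearMap.contDiff _).comp (contDiff_id.clm_apply contDiff_const)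

/-- `ψ` restricts to a diffeomorphism of the open set `X` onto an open set, expressed through the
hypotheses of the inverse function theorem. It is meant for finite-dimensional `E`: otherwise the
determinant is `1` by convention. -/
structure IsOpenSmoothEmbeddingOn {E : Type*} [NormedAddCommGroup E] [NormedSpace ℝ E]
    (ψ : E → E) (X : Set E) : Prop where
  isOpen : IsOpen X
  contDiffOn : ContDiffOn ℝ ∞ ψ X
  injOn : InjOn ψ X
  det_fderiv_ne_zero : ∀ x ∈ X, (fderiv ℝ ψ x).det ≠ 0

namespace IsOpenSmoothEmbeddingOn

variable {E : Type*} [NormedAddCommGroup E] [NormedSpace ℝ E] {ψ : E → E} {X : Set E}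

theorem hasFDerivAt (hψ : IsOpenSmoothEmbeddingOn ψ X) {x : E} (hx : x ∈ X) :
    HasFDerivAt ψ (fderiv ℝ ψ x) x :=
  ((hψ.contDiffOn.contDiffAt (hψ.isOpen.mem_nhds hx)).differentiableAt (by simp)).hasFDerivAt

variable [FiniteDimensional ℝ E]

theorem contDiffOn_abs_det_fderiv (hψ : IsOpenSmoothEmbeddingOn ψ X) :
    ContDiffOn ℝ ∞ (fun x => |(fderiv ℝ ψ x).det|) X :=
  (contDiff_continuousLinearMap_det.comp_contDiffOn
    (hψ.contDiffOn.fderiv_of_isOpen hψ.isOpen (by simp))).abs hψ.det_fderiv_ne_zero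

theorem contDiffOn_div_abs_det_fderiv (hψ : IsOpenSmoothEmbeddingOn ψ X) {w : E → ℂ}
    (hw : ContDiffOn ℝ ∞ w X) : ContDiffOn ℝ ∞ (fun x => w x / |(fderiv ℝ ψ x).det|) X := by
  simp only [div_eq_mul_inv]
  refine hw.mul ((Complex.ofRealCLM.contDiff.comp_contDiffOn hψ.contDiffOn_abs_det_fderiv).inv
    fun x hx => ?_)
  simpa using hψ.det_fderiv_ne_zero x hx

theorem isOpen_image (hψ : IsOpenSmoothEmbeddingOn ψ X) {U : Set E} (hU : IsOpen U)
    (hUX : U ⊆ X) : IsOpen (ψ '' U) := by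
  have : CompleteSpace E := FiniteDimensional.complete ℝ E
  rw [isOpen_iff_mem_nhds]
  rintro _ ⟨x, hx, rfl⟩
  have hstrict : HasStrictFDerivAt ψ ((fderiv ℝ ψ x).toContinuousLinearEquivOfDetNeZero
      (hψ.det_fderiv_ne_zero x (hUX hx)) : E →L[ℝ] E) x :=
    (hψ.contDiffOn.contDiffAt (hψ.isOpen.mem_nhds (hUX hx))).hasStrictFDerivAt (by simp)
  rw [← hstrict.map_nhds_eq_of_equiv]
  exact image_mem_map (hU.mem_nhds hx)

theorem isOpenMap_domRestrict (hψ : IsOpenSmoothEmbeddingOn ψ X) : IsOpenMap (X.domRestrict ψ) := by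
  intro V hV
  rw [domRestrict_eq, image_comp]
  exact hψ.isOpen_image (hψ.isOpen.isOpenMap_subtype_val V hV) (Subtype.coe_image_subset X V)

theorem contDiffOn_invFunOn (hψ : IsOpenSmoothEmbeddingOn ψ X) :
    ContDiffOn ℝ ∞ (Function.invFunOn ψ X) (ψ '' X) := by
  have : CompleteSpace E := FiniteDimensional.complete ℝ E
  let e : OpenPartialHomeomorph E E := OpenPartialHomeomorph.ofContinuousOpenRestrict
    (InjOn.toPartialEquiv ψ X hψ.injOn) hψ.contDiffOn.continuousOn hψ.isOpenMap_domRestrict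
    hψ.isOpen
  intro y hy
  have hx : Function.invFunOn ψ X y ∈ X := Function.invFunOn_mem hy
  exact (e.contDiffAt_symm
    (f₀' := (fderiv ℝ ψ _).toContinuousLinearEquivOfDetNeZero (hψ.det_fderiv_ne_zero _ hx)) hy
    (hψ.hasFDerivAt hx) (hψ.contDiffOn.contDiffAt (hψ.isOpen.mem_nhds hx))).contDiffWithinAt

end IsOpenSmoothEmbeddingOn

end OpenSmoothEmbedding

section DerivativeBounds

variable {E F G A : Type*} [NormedAddCommGroup E] [NormedSpace ℝ E]
  [NormedAddCommGroup F] [NormedSpace ℝ F] [NormedAddCommGroup G] [NormedSpace ℝ G]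
  [NormedRing A] [NormedAlgebra ℝ A] {X K : Set E}

theorem exists_norm_iteratedFDerivWithin_le_of_isCompact {f : E → F} (hX : IsOpen X)
    (hf : ContDiffOn ℝ ∞ f X) (hK : IsCompact K) (hKX : K ⊆ X) (k : ℕ) :
    ∃ C : ℝ, 1 ≤ C ∧ ∀ i ≤ k, ∀ x ∈ K, ‖iteratedFDerivWithin ℝ i f X x‖ ≤ C := by
  choose b hb using fun i : ℕ => hK.exists_bound_of_continuousOn
    ((hf.continuousOn_iteratedFDerivWithin (m := i) (by exact_mod_cast le_top)
      hX.uniqueDiffOn).mono hKX)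
  refine ⟨∑ i ∈ Finset.range (k + 1), |b i| + 1,
    le_add_of_nonneg_left (Finset.sum_nonneg fun i _ => abs_nonneg _), fun i hi x hx => ?_⟩
  have hbi : |b i| ≤ ∑ i ∈ Finset.range (k + 1), |b i| :=
    Finset.single_le_sum (fun i _ => abs_nonneg (b i)) (Finset.mem_range_succ_iff.2 hi)
  linarith [hb i x hx, le_abs_self (b i)]

theorem exists_norm_iteratedFDerivWithin_mul_le_mul {v : E → A} (hX : IsOpen X)
    (hv : ContDiffOn ℝ ∞ v X) (hK : IsCompact K) (hKX : K ⊆ X) (k : ℕ) :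
    ∃ C : ℝ, 0 ≤ C ∧ ∀ f : E → A, ContDiffOn ℝ ∞ f X → ∀ c : ℝ, ∀ x ∈ K,
      (∀ i ≤ k, ‖iteratedFDerivWithin ℝ i f X x‖ ≤ c) →
        ∀ i ≤ k, ‖iteratedFDerivWithin ℝ i (fun z => v z * f z) X x‖ ≤ C * c := by
  obtain ⟨M, hM1, hM⟩ := exists_norm_iteratedFDerivWithin_le_of_isCompact hX hv hK hKX k
  refine ⟨2 ^ k * M, by positivity, fun f hf c x hx hfc i hi => ?_⟩
  have hc : 0 ≤ c := (norm_nonneg _).trans (hfc 0 k.zero_le)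
  calc ‖iteratedFDerivWithin ℝ i (fun z => v z * f z) X x‖
      ≤ ∑ j ∈ Finset.range (i + 1), (i.choose j : ℝ) * ‖iteratedFDerivWithin ℝ j v X x‖ *
          ‖iteratedFDerivWithin ℝ (i - j) f X x‖ :=
        norm_iteratedFDerivWithin_mul_le hv hf hX.uniqueDiffOn (hKX hx)
          (by exact_mod_cast le_top)
    _ ≤ ∑ j ∈ Finset.range (i + 1), (i.choose j : ℝ) * M * c := by
        gcongr with j hj
        · exact hM j ((Finset.mem_range_succ_iff.1 hj).trans hi) x hx
        · exact hfc _ ((i.sub_le j).trans hi)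
    _ = 2 ^ i * M * c := by
        rw [← Finset.sum_mul, ← Finset.sum_mul]
        exact_mod_cast congrArg (fun n : ℕ => (n : ℝ) * M * c) (Nat.sum_range_choose i)
    _ ≤ 2 ^ k * M * c := by
        gcongr
        exact one_le_two

theorem exists_norm_iteratedFDerivWithin_comp_le_mul {g : E → F} {Y : Set F} (hX : IsOpen X)
    (hY : IsOpen Y) (hg : ContDiffOn ℝ ∞ g X) (hgY : MapsTo g X Y) (hK : IsCompact K)
    (hKX : K ⊆ X) (k : ℕ) :
    ∃ C : ℝ, 0 ≤ C ∧ ∀ f : F → G, ContDiffOn ℝ ∞ f Y → ∀ c : ℝ, ∀ x ∈ K,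
      (∀ i ≤ k, ‖iteratedFDerivWithin ℝ i f Y (g x)‖ ≤ c) →
        ‖iteratedFDerivWithin ℝ k (f ∘ g) X x‖ ≤ C * c := by
  obtain ⟨M, hM1, hM⟩ := exists_norm_iteratedFDerivWithin_le_of_isCompact hX hg hK hKX k
  refine ⟨k.factorial * M ^ k, by positivity, fun f hf c x hx hfc => ?_⟩
  rw [mul_right_comm]
  exact norm_iteratedFDerivWithin_comp_le (N := ∞) hf hg (by exact_mod_cast le_top)
    hY.uniqueDiffOn hX.uniqueDiffOn hgY (hKX hx) hfc fun i hi hik =>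
      (hM i hik x hx).trans (le_self_pow₀ hM1 (Nat.one_le_iff_ne_zero.1 hi))

end DerivativeBounds

section Transfer

variable {E : Type*} {X : Set E} {ψ : E → E} {v φ : E → ℂ}

/-- The function `(v · φ) ∘ ψ⁻¹` on `ψ(X)`, extended by zero. With `v = w / |det Dψ|` this is the
formal adjoint of the weighted composition `f ↦ w · (f ∘ ψ)`. -/
noncomputable def transfer [Nonempty E] (X : Set E) (ψ : E → E) (v φ : E → ℂ) : E → ℂ :=
  (ψ '' X).indicator ((fun x => v x * φ x) ∘ Function.invFunOn ψ X)

theorem isCompact_image_tsupport [TopologicalSpace E] (hψ : ContinuousOn ψ X)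
    (hφ : HasCompactSupport φ) (hφX : tsupport φ ⊆ X) : IsCompact (ψ '' tsupport φ) :=
  hφ.isCompact.image_of_continuousOn (hψ.mono hφX)

section Pointwise

variable [Nonempty E]

theorem eqOn_transfer : EqOn (transfer X ψ v φ)
    ((fun x => v x * φ x) ∘ Function.invFunOn ψ X) (ψ '' X) :=
  eqOn_indicator

theorem transfer_apply_map (hψ : InjOn ψ X) {x : E} (hx : x ∈ X) :
    transfer X ψ v φ (ψ x) = v x * φ x := by
  rw [eqOn_transfer (mem_image_of_mem ψ hx), Function.comp_apply, hψ.leftInvOn_invFunOn hx]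

theorem transfer_add (φ χ : E → ℂ) :
    transfer X ψ v (φ + χ) = transfer X ψ v φ + transfer X ψ v χ := by
  ext y
  by_cases hy : y ∈ ψ '' X <;> simp [transfer, hy, mul_add]

theorem transfer_smul (c : ℂ) (φ : E → ℂ) : transfer X ψ v (c • φ) = c • transfer X ψ v φ := by
  ext y
  by_cases hy : y ∈ ψ '' X <;> simp [transfer, hy, mul_left_comm]

theorem support_transfer_subset : Function.support (transfer X ψ v φ) ⊆
    ψ '' Function.support φ := by
  intro y hy
  have hyX : y ∈ ψ '' X := mem_of_indicator_ne_zero hy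
  rw [Function.mem_support, eqOn_transfer hyX] at hy
  exact ⟨_, right_ne_zero_of_mul hy, Function.invFunOn_eq hyX⟩

theorem support_transfer_subset_image_tsupport [TopologicalSpace E] :
    Function.support (transfer X ψ v φ) ⊆ ψ '' tsupport φ :=
  support_transfer_subset.trans (image_mono (subset_tsupport φ))

theorem image_tsupport_subset_tsupport_transfer [TopologicalSpace E] (hψ : ContinuousOn ψ X)
    (hψX : InjOn ψ X) (hX : IsOpen X)
    (hv : X ⊆ closure {x | x ∈ X ∧ v x ≠ 0}) (hφ : Continuous φ) (hφX : tsupport φ ⊆ X) :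
    ψ '' tsupport φ ⊆ tsupport (transfer X ψ v φ) := by
  let s := {x | x ∈ X ∧ v x ≠ 0} ∩ Function.support φ
  have hφs : Function.support φ ⊆ closure s := fun x hx =>
    closure_mono (inter_comm _ _).subset (hφ.isOpen_support.inter_closure
      ⟨hx, hv (hφX (subset_tsupport φ hx))⟩)
  rintro _ ⟨x, hx, rfl⟩
  have hxs : x ∈ closure s := closure_minimal hφs isClosed_closure hx
  refine ((hψ.continuousAt (hX.mem_nhds (hφX hx))).continuousWithinAt.mem_closure hxs ?_)
  rintro z ⟨⟨hzX, hvz⟩, hφz⟩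
  rw [Function.mem_support, transfer_apply_map hψX hzX]
  exact mul_ne_zero hvz hφz

theorem tsupport_transfer [TopologicalSpace E] [T2Space E] (hψ : ContinuousOn ψ X)
    (hψX : InjOn ψ X) (hX : IsOpen X) (hv : X ⊆ closure {x | x ∈ X ∧ v x ≠ 0})
    (hφ : Continuous φ) (hφc : HasCompactSupport φ) (hφX : tsupport φ ⊆ X) :
    tsupport (transfer X ψ v φ) = ψ '' tsupport φ :=
  (closure_minimal support_transfer_subset_image_tsupport
    (isCompact_image_tsupport hψ hφc hφX).isClosed).antisymm
    (image_tsupport_subset_tsupport_transfer hψ hψX hX hv hφ hφX)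

end Pointwise

variable [NormedAddCommGroup E] [NormedSpace ℝ E] [FiniteDimensional ℝ E]

theorem contDiff_transfer (hψ : IsOpenSmoothEmbeddingOn ψ X) (hv : ContDiffOn ℝ ∞ v X)
    (hφ : ContDiff ℝ ∞ φ) (hφc : HasCompactSupport φ) (hφX : tsupport φ ⊆ X) :
    ContDiff ℝ ∞ (transfer X ψ v φ) := by
  refine contDiff_iff_contDiffAt.2 fun y => ?_
  by_cases hy : y ∈ ψ '' X
  · have hψXy : ψ '' X ∈ 𝓝 y := (hψ.isOpen_image hψ.isOpen subset_rfl).mem_nhds hy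
    refine (((hv.mul hφ.contDiffOn).comp hψ.contDiffOn_invFunOn fun z hz =>
      Function.invFunOn_mem hz).contDiffAt hψXy).congr_of_eventuallyEq ?_
    exact eqOn_transfer.eventuallyEq_of_mem hψXy
  · have hclosed : IsClosed (ψ '' tsupport φ) :=
      (isCompact_image_tsupport hψ.contDiffOn.continuousOn hφc hφX).isClosed
    refine (contDiffAt_const (c := (0 : ℂ))).congr_of_eventuallyEq ?_
    filter_upwards [hclosed.isOpen_compl.mem_nhds fun h => hy (image_mono hφX h)] with z hz
    exact Function.notMem_support.1 fun h => hz (support_transfer_subset_image_tsupport h)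

theorem exists_norm_iteratedFDeriv_transfer_le_mul (hψ : IsOpenSmoothEmbeddingOn ψ X)
    (hv : ContDiffOn ℝ ∞ v X) {K : Set E} (hK : IsCompact K) (hKX : K ⊆ X) (k : ℕ) :
    ∃ C : ℝ, 0 ≤ C ∧ ∀ φ : E → ℂ, ContDiff ℝ ∞ φ → ∀ c : ℝ,
      (∀ i ≤ k, ∀ x ∈ K, ‖iteratedFDeriv ℝ i φ x‖ ≤ c) →
        ∀ y ∈ ψ '' K, ‖iteratedFDeriv ℝ k (transfer X ψ v φ) y‖ ≤ C * c := by
  have hψX : IsOpen (ψ '' X) := hψ.isOpen_image hψ.isOpen subset_rfl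
  obtain ⟨C₁, hC₁, hmul⟩ := exists_norm_iteratedFDerivWithin_mul_le_mul hψ.isOpen hv hK hKX k
  obtain ⟨C₂, hC₂, hcomp⟩ := exists_norm_iteratedFDerivWithin_comp_le_mul (G := ℂ) hψX hψ.isOpen
    hψ.contDiffOn_invFunOn (fun z hz => Function.invFunOn_mem hz)
    (hK.image_of_continuousOn (hψ.contDiffOn.continuousOn.mono hKX)) (image_mono hKX) k
  refine ⟨C₂ * C₁, mul_nonneg hC₂ hC₁, fun φ hφ c hc => ?_⟩
  rintro _ ⟨x, hx, rfl⟩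
  have hy : ψ x ∈ ψ '' X := mem_image_of_mem ψ (hKX hx)
  rw [← iteratedFDerivWithin_of_isOpen k hψX hy,
    iteratedFDerivWithin_congr eqOn_transfer hy, mul_assoc]
  refine hcomp _ (hv.mul hφ.contDiffOn) _ _ (mem_image_of_mem ψ hx) ?_
  rw [hψ.injOn.leftInvOn_invFunOn (hKX hx)]
  refine hmul φ hφ.contDiffOn c x hx fun i hi => ?_
  rw [iteratedFDerivWithin_of_isOpen i hψ.isOpen (hKX hx)]
  exact hc i hi x hx

theorem integral_transfer_mul [MeasurableSpace E] [BorelSpace E] (μ : Measure E)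
    [μ.IsAddHaarMeasure] (hψ : IsOpenSmoothEmbeddingOn ψ X) (w φ f : E → ℂ) :
    ∫ y, transfer X ψ (fun x => w x / |(fderiv ℝ ψ x).det|) φ y * f y ∂μ =
      ∫ x in X, φ x * (w x * f (ψ x)) ∂μ := by
  rw [← setIntegral_eq_integral_of_forall_compl_eq_zero (s := ψ '' X)
    fun y hy => by rw [transfer, indicator_of_notMem hy, zero_mul],
    integral_image_eq_integral_abs_det_fderiv_smul μ hψ.isOpen.measurableSet
      (fun x hx => (hψ.hasFDerivAt hx).hasFDerivWithinAt) hψ.injOn]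
  refine setIntegral_congr_fun hψ.isOpen.measurableSet fun x hx => ?_
  have hdet : ((|(fderiv ℝ ψ x).det| : ℝ) : ℂ) ≠ 0 := by
    simpa using hψ.det_fderiv_ne_zero x hx
  simp only [transfer_apply_map hψ.injOn hx, Complex.real_smul]
  field_simp

end Transfer

section TransferCLM

variable {E : Type*} [NormedAddCommGroup E] [NormedSpace ℝ E] [FiniteDimensional ℝ E]
  {Ω : Opens E} {ψ : E → E} {v : E → ℂ}

/-- `transfer` as a continuous linear map between spaces of functions supported in fixed compact
sets. -/
noncomputable def transferSupportedIn (hψ : IsOpenSmoothEmbeddingOn ψ Ω)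
    (hv : ContDiffOn ℝ ∞ v Ω) {K L : Compacts E} (hK : (K : Set E) ⊆ Ω) (hL : ψ '' K = L) :
    𝓓_{K}(E, ℂ) →L[ℂ] 𝓓_{L}(E, ℂ) :=
  ContDiffMapSupportedIn.mkCLM ℂ (fun φ => transfer Ω ψ v φ)
    (fun φ χ => congrFun (transfer_add φ χ)) (fun c φ => congrFun (transfer_smul c φ))
    (fun φ => contDiff_transfer hψ hv φ.contDiff φ.hasCompactSupport
      (φ.tsupport_subset.trans hK))
    (fun φ y hy => Function.notMem_support.1 fun h =>
      hy (hL ▸ image_mono φ.support_subset (support_transfer_subset h)))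
    (fun k _ => by
      obtain ⟨C, hC0, hC⟩ := exists_norm_iteratedFDeriv_transfer_le_mul hψ hv K.isCompact hK k
      refine ⟨Finset.Iic k, C, hC0, fun φ y hy => hC φ φ.contDiff _ (fun i hi x _ => ?_) y
        (hL ▸ hy)⟩
      exact (ContDiffMapSupportedIn.norm_iteratedFDeriv_apply_le_seminorm_top ℂ).trans
        (Seminorm.le_finset_sup_apply (Finset.mem_Iic.2 hi)))

/-- `transfer` as a continuous operator on test functions. -/
noncomputable def transferCLM (hψ : IsOpenSmoothEmbeddingOn ψ Ω) (hψΩ : MapsTo ψ Ω Ω)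
    (hv : ContDiffOn ℝ ∞ v Ω) : 𝓓(Ω, ℂ) →L[ℂ] 𝓓(Ω, ℂ) :=
  TestFunction.mkCLM ℂ
    (fun φ =>
      have hc := isCompact_image_tsupport hψ.contDiffOn.continuousOn φ.hasCompactSupport
        φ.tsupport_subset
      ⟨transfer Ω ψ v φ,
        contDiff_transfer hψ hv φ.contDiff φ.hasCompactSupport φ.tsupport_subset,
        .of_support_subset_isCompact hc support_transfer_subset_image_tsupport,
        (closure_minimal support_transfer_subset_image_tsupport hc.isClosed).trans
          ((image_mono φ.tsupport_subset).trans hψΩ.image_subset)⟩)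
    (fun φ χ => TestFunction.ext (congrFun (transfer_add φ χ)))
    (fun c φ => TestFunction.ext (congrFun (transfer_smul c φ)))
    (fun K hK =>
      let L : Compacts E :=
        ⟨ψ '' K, K.isCompact.image_of_continuousOn (hψ.contDiffOn.continuousOn.mono hK)⟩
      ((TestFunction.ofSupportedInCLM ℂ
        (show (L : Set E) ⊆ Ω from (image_mono hK).trans hψΩ.image_subset)).comp
          (transferSupportedIn hψ hv hK rfl)).continuous)

theorem tsupport_transferCLM (hψ : IsOpenSmoothEmbeddingOn ψ Ω) (hψΩ : MapsTo ψ Ω Ω)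
    (hv : ContDiffOn ℝ ∞ v Ω) (hv_dense : (Ω : Set E) ⊆ closure {x | x ∈ Ω ∧ v x ≠ 0})
    (φ : 𝓓(Ω, ℂ)) : tsupport (transferCLM hψ hψΩ hv φ) = ψ '' tsupport φ :=
  tsupport_transfer hψ.contDiffOn.continuousOn hψ.injOn hψ.isOpen hv_dense φ.continuous
    φ.hasCompactSupport φ.tsupport_subset

end TransferCLM

section WeightedComposition

variable {d : ℕ} {X : Opens (RSpace d)} {w : RSpace d → ℂ} {ψ : RSpace d → RSpace d}

/-- The operator `φ ↦ ((w / |det Dψ|) · φ) ∘ ψ⁻¹` on `𝓓(X)`, whose transpose is the weighted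
composition operator with weight `w` and symbol `ψ`. -/
noncomputable def weightedCompositionPredual (hψ : IsOpenSmoothEmbeddingOn ψ X)
    (hψX : MapsTo ψ X X) (hw : ContDiffOn ℝ ∞ w X) : 𝓓(X, ℂ) →L[ℂ] 𝓓(X, ℂ) :=
  transferCLM hψ hψX (hψ.contDiffOn_div_abs_det_fderiv hw)

theorem tsupport_weightedCompositionPredual (hψ : IsOpenSmoothEmbeddingOn ψ X)
    (hψX : MapsTo ψ X X) (hw : ContDiffOn ℝ ∞ w X)
    (hw_dense : (X : Set (RSpace d)) ⊆ closure {x | x ∈ X ∧ w x ≠ 0}) (φ : 𝓓(X, ℂ)) :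
    tsupport (weightedCompositionPredual hψ hψX hw φ) = ψ '' tsupport φ := by
  refine tsupport_transferCLM _ _ _ (hw_dense.trans (closure_mono fun x hx => ⟨hx.1, ?_⟩)) φ
  exact div_ne_zero hx.2 (by simpa using hψ.det_fderiv_ne_zero x hx.1)

theorem isWeightedCompositionOperator_strongTranspose (hψ : IsOpenSmoothEmbeddingOn ψ X)
    (hψX : MapsTo ψ X X) (hw : ContDiffOn ℝ ∞ w X) :
    IsWeightedCompositionOperator X w ψ
      (strongTranspose (weightedCompositionPredual hψ hψX hw)) := by
  intro f hf
  ext φ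
  have hwf : ContinuousOn (fun x => w x * f (ψ x)) X :=
    hw.continuousOn.mul (hf.comp hψ.contDiffOn.continuousOn hψX)
  calc regularDist X f (weightedCompositionPredual hψ hψX hw φ)
      = ∫ y, weightedCompositionPredual hψ hψX hw φ y * f y := regularDist_apply hf _
    _ = ∫ x in X, φ x * (w x * f (ψ x)) := integral_transfer_mul volume hψ w φ f
    _ = ∫ x, φ x * (w x * f (ψ x)) := setIntegral_eq_integral_of_forall_compl_eq_zero fun x hx =>
        by rw [image_eq_zero_of_notMem_tsupport fun h => hx (φ.tsupport_subset h), zero_mul]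
    _ = regularDist X (fun x => w x * f (ψ x)) φ := (regularDist_apply hwf φ).symm

theorem eq_of_isWeightedCompositionOperator {T T' : DistSpace X →L[ℂ] DistSpace X}
    (hT : IsWeightedCompositionOperator X w ψ T) (hT' : IsWeightedCompositionOperator X w ψ T') :
    T = T' := by
  refine DFunLike.coe_injective
    (T.continuous.ext_on dense_regularDist_image_continuous T'.continuous ?_)
  rintro _ ⟨f, hf : Continuous f, rfl⟩
  rw [hT f hf.continuousOn, hT' f hf.continuousOn]

end WeightedComposition

theorem mainTheorem2 (d : ℕ) (X : TopologicalSpace.Opens (RSpace d))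
    (w : RSpace d → ℂ) (hw : ContDiffOn ℝ ∞ w X)
    (hw_dense : (X : Set (RSpace d)) ⊆ closure {x | x ∈ X ∧ w x ≠ 0})
    (ψ : RSpace d → RSpace d) (hψ_maps : Set.MapsTo ψ X X)
    (hψ : ContDiffOn ℝ ∞ ψ X) (hψ_inj : Set.InjOn ψ X)
    (hψ_det : ∀ x ∈ X, (fderiv ℝ ψ x).det ≠ 0) :
    (∃! T : DistSpace X →L[ℂ] DistSpace X, IsWeightedCompositionOperator X w ψ T) ∧
    ∀ T : DistSpace X →L[ℂ] DistSpace X, IsWeightedCompositionOperator X w ψ T →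
      (IsTopologizable T ↔ HasStableOrbitsOn (X : Set (RSpace d)) ψ) := by
  have hψ_emb : IsOpenSmoothEmbeddingOn ψ X := ⟨X.isOpen, hψ, hψ_inj, hψ_det⟩
  have hT₀ := isWeightedCompositionOperator_strongTranspose hψ_emb hψ_maps hw
  refine ⟨⟨_, hT₀, fun T hT => eq_of_isWeightedCompositionOperator hT hT₀⟩, fun T hT => ?_⟩
  rw [eq_of_isWeightedCompositionOperator hT hT₀]
  exact isTopologizable_strongTranspose_iff_hasStableOrbitsOn
    (tsupport_weightedCompositionPredual hψ_emb hψ_maps hw hw_dense)
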